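/- Let $S$ be a finite nonempty set, $P$ an irreducible stochastic matrix on $S$ and $f:S\to\mathbb R$. Put $b=\max_{x}f(x)$ and $S_b=\{x\in S: f(x)=b\}$. Assume that (1) the submatrix of $P$ with rows and columns in $S_b$ is irreducible (a $1\times1$ matrix counting as irreducible only if its entry is nonzero), and (2) for every $x\in S\setminus S_b$ there is $y\in S_b$ with $P(x,y)>0$. For $\theta\in\mathbb R$ let $\overline P_\theta(x,y)=e^{-\theta b}P(x,y)e^{\theta f(y)}$. Let $u_\theta,v_\theta$ be its left and right Perron--Frobenius eigenvectors, i.e. the unique entrywise positive vectors with $u_\theta^{\top}\overline P_\theta=\rho\, u_\theta^{\top}$, $\overline P_\theta v_\theta=\rho\, v_\theta$, $\sum_x u_\theta(x)=1$ and $\sum_x u_\theta(x)v_\theta(x)=1$, where $\rho$ is the spectral radius of $\overline P_\theta$. Then these vectors exist and are unique for every $\theta\in\mathbb R$, every ratio $\theta\mapsto v_\theta(x)/v_\theta(y)$ is differentiable on $\mathbb R$, and $$K_u:=\sup_{\theta\ge0,\;x,y\in S}\frac{v_\theta(x)}{v_\theta(y)}<\infty,\qquad L_u:=\sup_{\theta\ge0,\;x,y\in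 S}\left|\frac{d}{d\theta}\frac{v_\theta(x)}{v_\theta(y)}\right|<\infty .$$ Moreover, if all rows of $P$ are identical (the IID case), then $K_u=1$ and $L_u=0$; and if all entries of $P$ are positive, then $$K_u\le\max_{x,y,z\in S}\frac{P(x,z)}{P(y,z)}.$$ -/

import Mathlib

open scoped Matrix

namespace TiltedChain

/-- The spectral radius of a real square matrix: the largest modulus of its complex eigenvalues. -/
noncomputable def matrixSpectralRadius {S : Type*} [Fintype S] [DecidableEq S]
    (M : Matrix S S ℝ) : ℝ :=
  (spectralRadius ℂ (M.map (algebraMap ℝ ℂ))).toReal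

/-- `u` and `v` are entrywise positive left and right eigenvectors of `M` for the eigenvalue `ρ(M)`,
normalized by `∑ u x = 1` and `∑ u x * v x = 1`. -/
structure IsPerronFrobeniusPair {S : Type*} [Fintype S] [DecidableEq S]
    (M : Matrix S S ℝ) (u v : S → ℝ) : Prop where
  left_pos : ∀ x, 0 < u x
  right_pos : ∀ x, 0 < v x
  left_eigen : u ᵥ* M = matrixSpectralRadius M • u
  right_eigen : M *ᵥ v = matrixSpectralRadius M • v
  left_sum : ∑ x, u x = 1
  pair_sum : ∑ x, u x * v x = 1

/-- The pair of normalized Perron-Frobenius eigenvectors (left, right) of `M`.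
(A junk value if `M` has no such pair.) -/
noncomputable def perronFrobeniusPair {S : Type*} [Fintype S] [DecidableEq S]
    (M : Matrix S S ℝ) : (S → ℝ) × (S → ℝ) :=
  Classical.epsilon fun uv : (S → ℝ) × (S → ℝ) => IsPerronFrobeniusPair M uv.1 uv.2

/-- The normalized right Perron-Frobenius eigenvector `v_M` of `M`. -/
noncomputable def rightEigenvector {S : Type*} [Fintype S] [DecidableEq S]
    (M : Matrix S S ℝ) : S → ℝ :=
  (perronFrobeniusPair M).2

/-- `b = max_x f x`. -/
noncomputable def maxValue {S : Type*} [Fintype S] [Nonempty S] (f : S → ℝ) : ℝ :=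
  Finset.univ.sup' Finset.univ_nonempty f

/-- `S_b = {x : f x = b}`. -/
def maxSet {S : Type*} [Fintype S] [Nonempty S] (f : S → ℝ) : Set S :=
  {x | f x = maxValue f}

/-- The exponential tilt `P̃_θ (x, y) = P (x, y) * exp (θ * f y)`. -/
noncomputable def tilt {S : Type*} (P : Matrix S S ℝ) (f : S → ℝ) (θ : ℝ) : Matrix S S ℝ :=
  Matrix.of fun x y => P x y * Real.exp (θ * f y)

/-- The rescaled tilt `P̄_θ = exp (-θ * b) • P̃_θ`, where `b = max f`. -/
noncomputable def scaledTilt {S : Type*} [Fintype S] [Nonempty S]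
    (P : Matrix S S ℝ) (f : S → ℝ) (θ : ℝ) : Matrix S S ℝ :=
  Real.exp (-θ * maxValue f) • tilt P f θ

/-- The ratio `v (x) / v (y)` for `v` the right Perron-Frobenius eigenvector of `P̄_θ`. -/
noncomputable def evecRatio {S : Type*} [Fintype S] [DecidableEq S] [Nonempty S]
    (P : Matrix S S ℝ) (f : S → ℝ) (x y : S) (θ : ℝ) : ℝ :=
  rightEigenvector (scaledTilt P f θ) x / rightEigenvector (scaledTilt P f θ) y

/-- All values of the eigenvector ratios over `θ ≥ 0` and `x, y ∈ S`. -/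
def ratioValues {S : Type*} [Fintype S] [DecidableEq S] [Nonempty S]
    (P : Matrix S S ℝ) (f : S → ℝ) : Set ℝ :=
  {r | ∃ θ : ℝ, 0 ≤ θ ∧ ∃ x y : S, r = evecRatio P f x y θ}

/-- All absolute values of the `θ`-derivatives of the eigenvector ratios over `θ ≥ 0`
and `x, y ∈ S`. -/
def ratioDerivValues {S : Type*} [Fintype S] [DecidableEq S] [Nonempty S]
    (P : Matrix S S ℝ) (f : S → ℝ) : Set ℝ :=
  {r | ∃ θ : ℝ, 0 ≤ θ ∧ ∃ x y : S, r = |deriv (evecRatio P f x y) θ|}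

/-- The constant `K_u (P, f)`. -/
noncomputable def Ku {S : Type*} [Fintype S] [DecidableEq S] [Nonempty S]
    (P : Matrix S S ℝ) (f : S → ℝ) : ℝ :=
  sSup (ratioValues P f)

/-- The constant `L_u (P, f)`. -/
noncomputable def Lu {S : Type*} [Fintype S] [DecidableEq S] [Nonempty S]
    (P : Matrix S S ℝ) (f : S → ℝ) : ℝ :=
  sSup (ratioDerivValues P f)

end TiltedChain

/-!
Write `ρ`, `v` for the Perron–Frobenius eigenvalue and right eigenvector of
`P̄_θ (x, y) = P (x, y) exp (θ (f y - b))`, with `b = max f`.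

Existence and uniqueness are the Perron–Frobenius theorem for irreducible matrices, which is proved
here by maximizing `r` subject to `r x ≤ M x` over the simplex (`exists_pos_eigenvector`,
`eigenvector_unique`, `matrixSpectralRadius_eq`). Since the eigenvalue is simple, the implicit function
theorem provides locally a differentiable choice of positive eigenvectors, and ratios of entries do not
depend on the normalization (`exists_differentiableAt_eigenvector`, `rightEigenvector_div`).

For `θ ≥ 0` the matrix `P̄_θ` is substochastic, so `ρ ≤ 1`, while its columns at the maximizing states
`S_b` do not depend on `θ`. Hence `P (x, y) v y ≤ v x` for `y ∈ S_b`, and following paths that enter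
`S_b` and stay there, every entry of `v` dominates the entries on `S_b`
(`exists_le_mul_of_mem_maxSet`). Conversely `ρ` is bounded below by a positive entry of `P` on `S_b`,
whereas the columns outside `S_b` tend to `0`; so for large `θ` the entries of `v` outside `S_b` are
dominated by those on `S_b` (`exists_le_mul_of_large`). For bounded `θ` irreducibility of `P` suffices
(`exists_le_mul_of_bounded`).

For the derivatives, let `g = v' / v`, for any differentiable normalization of `v`. Differentiating
`P̄_θ v = ρ v` shows that
`∑ y, P̄_θ (x, y) v y (g y - g x + f y - b) = ρ' v x` (`sum_logDeriv_eq`). At a maximum and at a minimum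
of `g` this bounds `ρ'`. It then bounds `max g - g` and `g - min g` at `y ∈ S_b` in terms of their
values at `x` whenever `P (x, y) > 0`, and paths from the extrema of `g` into `S_b` bound the
oscillation of `g` (`exists_logDeriv_sub_le`). The derivative of `v x / v y` is
`(v x / v y) (g x - g y)`.
-/

namespace TiltedChain

section

variable {S : Type*} [Fintype S] {M : Matrix S S ℝ}

/-! ### Irreducible matrices -/

/-- In the graph of an irreducible matrix, a property that holds at one vertex and is passed on along
edges holds everywhere. -/
lemma forall_of_isIrreducible {n : Type*} {A : Matrix n n ℝ} (hA : A.IsIrreducible) {C : n → Prop}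
    (i : n) (hi : C i) (hstep : ∀ a b, 0 < A a b → C a → C b) (j : n) : C j := by
  let := A.toQuiver
  obtain ⟨p, -⟩ := hA.connected i j
  induction p with
  | nil => exact hi
  | cons p e ih => exact hstep _ _ e.down ih

/-- The form of `forall_of_isIrreducible` in which the property is passed on against the edges. -/
lemma forall_of_isIrreducible_reverse {n : Type*} {A : Matrix n n ℝ} (hA : A.IsIrreducible)
    {C : n → Prop} (j : n) (hj : C j) (hstep : ∀ a b, 0 < A a b → C b → C a) (i : n) : C i :=
  forall_of_isIrreducible hA.transpose j hj (fun a b hab ha => hstep b a hab ha) i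

/-- Unlike `Matrix.IsIrreducible.exists_pos`, this covers the `1 × 1` case. -/
lemma exists_pos_of_isIrreducible {n : Type*} {A : Matrix n n ℝ} (hA : A.IsIrreducible) (i : n) :
    ∃ j, 0 < A i j := by
  rcases subsingleton_or_nontrivial n with h | h
  · let := A.toQuiver
    obtain ⟨p, hp⟩ := hA.connected i i
    cases p with
    | nil => simp at hp
    | @cons b _ q e => exact ⟨i, by simpa [Subsingleton.elim b i] using e.down⟩
  · exact hA.exists_pos i

lemma isIrreducible_of_pos_of_pos {n : Type*} {A B : Matrix n n ℝ} (hA : A.IsIrreducible)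
    (hB : ∀ i j, 0 ≤ B i j) (h : ∀ i j, 0 < A i j → 0 < B i j) : B.IsIrreducible := by
  refine ⟨hB, fun i j => ?_⟩
  obtain ⟨p, hp⟩ := hA.connected i j
  suffices ∀ k, ∀ q : @Quiver.Path n A.toQuiver i k,
      ∃ q' : @Quiver.Path n B.toQuiver i k, @Quiver.Path.length n A.toQuiver i k q =
        @Quiver.Path.length n B.toQuiver i k q' by
    obtain ⟨q', hq'⟩ := this j p
    exact ⟨q', hq' ▸ hp⟩
  intro k q
  induction q with
  | nil => exact ⟨@Quiver.Path.nil n B.toQuiver i, rfl⟩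
  | @cons b c q e ih =>
    obtain ⟨q', hq'⟩ := ih
    refine ⟨@Quiver.Path.cons n B.toQuiver i b c q' (PLift.up (h _ _ e.down)), ?_⟩
    exact congrArg (· + 1) hq'

/-! ### The Perron–Frobenius theorem -/

lemma mulVec_apply (M : Matrix S S ℝ) (v : S → ℝ) (x : S) : (M *ᵥ v) x = ∑ y, M x y * v y := rfl

lemma mul_le_mulVec_apply (hM : ∀ x y, 0 ≤ M x y) {v : S → ℝ} (hv : ∀ x, 0 ≤ v x) (x y : S) :
    M x y * v y ≤ (M *ᵥ v) x :=
  Finset.single_le_sum (f := fun y => M x y * v y) (fun y _ => mul_nonneg (hM x y) (hv y))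
    (Finset.mem_univ y)

/-- The eigenvalue of a positive eigenvector is positive. -/
lemma eigenvalue_pos [Nonempty S] (hM : M.IsIrreducible) {v : S → ℝ} (hv : ∀ x, 0 < v x) {r : ℝ}
    (h : M *ᵥ v = r • v) : 0 < r := by
  obtain ⟨x⟩ := ‹Nonempty S›
  obtain ⟨y, hy⟩ := exists_pos_of_isIrreducible hM x
  have h1 := mul_le_mulVec_apply hM.nonneg (fun x => (hv x).le) x y
  rw [h, Pi.smul_apply, smul_eq_mul] at h1
  exact pos_of_mul_pos_left ((mul_pos hy (hv y)).trans_le h1) (hv x).le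

/-- A nonnegative eigenvector with one positive entry is positive. -/
lemma pos_of_eigenvector (hM : M.IsIrreducible) {v : S → ℝ} (hv : ∀ x, 0 ≤ v x) {r : ℝ}
    (h : M *ᵥ v = r • v) {x₀ : S} (hx₀ : 0 < v x₀) (x : S) : 0 < v x := by
  refine forall_of_isIrreducible_reverse hM (C := fun x => 0 < v x) x₀ hx₀ (fun a b hab hb => ?_) x
  refine (hv a).lt_of_ne fun h0 => ?_
  have h1 := mul_le_mulVec_apply hM.nonneg hv a b
  rw [h, Pi.smul_apply, ← h0, smul_zero] at h1
  exact absurd h1 (not_le.2 (mul_pos hab hb))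

/-- The eigenspace of a positive eigenvector is one-dimensional: subtract the largest multiple of `v`
that keeps the difference nonnegative. -/
lemma eigenvector_unique [Nonempty S] (hM : M.IsIrreducible) {v w : S → ℝ} (hv : ∀ x, 0 < v x)
    {r : ℝ} (h : M *ᵥ v = r • v) (hw : M *ᵥ w = r • w) : ∃ t : ℝ, w = t • v := by
  obtain ⟨x₀, hx₀⟩ := Finite.exists_min (fun x => w x / v x)
  set t := w x₀ / v x₀ with ht
  refine ⟨t, ?_⟩
  have hz : ∀ x, 0 ≤ (w - t • v) x := fun x => by
    have := (le_div_iff₀ (hv x)).1 (hx₀ x)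
    simpa using this
  have hz₀ : (w - t • v) x₀ = 0 := by
    simp [ht, div_mul_cancel₀ _ (hv x₀).ne']
  have hMz : M *ᵥ (w - t • v) = r • (w - t • v) := by
    rw [Matrix.mulVec_sub, Matrix.mulVec_smul, h, hw, smul_sub, smul_comm]
  by_contra hne
  obtain ⟨x₁, hx₁⟩ : ∃ x, (w - t • v) x ≠ 0 := by
    by_contra! hall
    exact hne (sub_eq_zero.1 (funext hall))
  have := pos_of_eigenvector hM hz hMz ((hz x₁).lt_of_ne' hx₁) x₀
  exact this.ne' hz₀

lemma mulVec_pos {B : Matrix S S ℝ} (hB : ∀ x y, 0 < B x y) {v : S → ℝ} (hv : ∀ x, 0 ≤ v x)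
    {x₀ : S} (hx₀ : 0 < v x₀) (x : S) : 0 < (B *ᵥ v) x :=
  (mul_pos (hB x x₀) hx₀).trans_le (mul_le_mulVec_apply (fun x y => (hB x y).le) hv x x₀)

variable [DecidableEq S]

/-- Some polynomial in an irreducible matrix is entrywise positive. -/
lemma exists_commute_pos (hM : M.IsIrreducible) :
    ∃ B : Matrix S S ℝ, Commute M B ∧ ∀ x y, 0 < B x y := by
  choose k hk hpos using (Matrix.isIrreducible_iff_exists_pow_pos hM.nonneg).1 hM
  refine ⟨∑ p : S × S, M ^ k p.1 p.2, Commute.sum_right _ _ _ fun p _ => Commute.pow_right rfl _,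
    fun x y => ?_⟩
  rw [Matrix.sum_apply]
  exact Finset.sum_pos' (fun p _ => Matrix.pow_apply_nonneg hM.nonneg _ _ _)
    ⟨(x, y), Finset.mem_univ _, hpos x y⟩

/-- Existence in the Perron–Frobenius theorem: a maximizer `x` of the Collatz–Wielandt problem
`r x ≤ M x` on the simplex is an eigenvector, as otherwise `B x`, with `B` a positive matrix commuting
with `M`, admits a larger `r`. -/
lemma exists_pos_eigenvector [Nonempty S] (hM : M.IsIrreducible) :
    ∃ (r : ℝ) (v : S → ℝ), (∀ x, 0 < v x) ∧ M *ᵥ v = r • v := by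
  obtain ⟨B, hMB, hB⟩ := exists_commute_pos hM
  set R : ℝ := ∑ x, ∑ y, M x y
  have hR : 0 ≤ R := Finset.sum_nonneg fun x _ => Finset.sum_nonneg fun y _ => hM.nonneg x y
  let K : Set ((S → ℝ) × ℝ) := (stdSimplex ℝ S ×ˢ Set.Icc 0 R) ∩
    {p | ∀ x, p.2 * p.1 x ≤ (M *ᵥ p.1) x}
  have hKc : IsCompact K := by
    refine ((isCompact_stdSimplex ℝ S).prod isCompact_Icc).inter_right ?_
    simp only [Set.ofPred_forall]
    refine isClosed_iInter fun x => isClosed_le (by fun_prop) ?_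
    simp only [mulVec_apply]
    fun_prop
  have hbound : ∀ (v : S → ℝ) (r : ℝ), v ∈ stdSimplex ℝ S →
      (∀ x, r * v x ≤ (M *ᵥ v) x) → r ≤ R := by
    intro v r hv h
    calc r = ∑ x, r * v x := by rw [← Finset.mul_sum, hv.2, mul_one]
      _ ≤ ∑ x, (M *ᵥ v) x := Finset.sum_le_sum fun x _ => h x
      _ ≤ R := Finset.sum_le_sum fun x _ => Finset.sum_le_sum fun y _ =>
        mul_le_of_le_one_right (hM.nonneg x y) <| by
          rw [← hv.2]
          exact Finset.single_le_sum (fun z _ => hv.1 z) (Finset.mem_univ y)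
  have hKn : K.Nonempty := by
    obtain ⟨x₀⟩ := ‹Nonempty S›
    refine ⟨(Pi.single x₀ 1, 0), ⟨single_mem_stdSimplex ℝ x₀, ⟨le_rfl, hR⟩⟩, fun x => ?_⟩
    rw [zero_mul]
    exact Finset.sum_nonneg fun y _ => mul_nonneg (hM.nonneg x y)
      ((single_mem_stdSimplex ℝ x₀).1 y)
  obtain ⟨⟨v, r⟩, ⟨⟨hv, hr⟩, hvr⟩, hmax⟩ := hKc.exists_isMaxOn hKn continuous_snd.continuousOn
  simp only at hv hr hvr
  have hv₀ : ∃ x, 0 < v x := by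
    by_contra! h
    have := hv.2
    rw [Finset.sum_eq_zero fun x _ => le_antisymm (h x) (hv.1 x)] at this
    exact zero_ne_one this
  obtain ⟨x₀, hx₀⟩ := hv₀
  have heig : M *ᵥ v = r • v := by
    by_contra hne
    set d := M *ᵥ v - r • v with hd
    have hd0 : ∀ x, 0 ≤ d x := fun x => sub_nonneg.2 (hvr x)
    obtain ⟨x₁, hx₁⟩ : ∃ x, d x ≠ 0 := by
      by_contra! hall
      exact hne (sub_eq_zero.1 (funext hall))
    have hy : ∀ x, 0 < (B *ᵥ v) x := mulVec_pos hB hv.1 hx₀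
    have hBd : ∀ x, 0 < (B *ᵥ d) x := mulVec_pos hB hd0 ((hd0 x₁).lt_of_ne' hx₁)
    have hMy : M *ᵥ (B *ᵥ v) = r • (B *ᵥ v) + B *ᵥ d := by
      rw [hd, Matrix.mulVec_sub, Matrix.mulVec_mulVec, hMB.eq, Matrix.mulVec_smul,
        Matrix.mulVec_mulVec]
      abel
    obtain ⟨x₂, hx₂⟩ := Finite.exists_min (fun x => (B *ᵥ d) x / (B *ᵥ v) x)
    set ε := (B *ᵥ d) x₂ / (B *ᵥ v) x₂ with hε
    have hεpos : 0 < ε := div_pos (hBd _) (hy _)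
    set s := ∑ x, (B *ᵥ v) x with hs
    have hspos : 0 < s := Finset.sum_pos (fun x _ => hy x) Finset.univ_nonempty
    have hsimp : s⁻¹ • (B *ᵥ v) ∈ stdSimplex ℝ S := by
      refine ⟨fun x => mul_nonneg (inv_nonneg.2 hspos.le) (hy x).le, ?_⟩
      simp only [Pi.smul_apply, smul_eq_mul, ← Finset.mul_sum]
      exact inv_mul_cancel₀ hspos.ne'
    have hle : ∀ x, (r + ε) * (s⁻¹ • (B *ᵥ v)) x ≤ (M *ᵥ (s⁻¹ • (B *ᵥ v))) x := by
      intro x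
      rw [Matrix.mulVec_smul, hMy]
      have := (le_div_iff₀ (hy x)).1 (hx₂ x)
      simp only [Pi.smul_apply, Pi.add_apply, smul_eq_mul]
      rw [mul_left_comm]
      refine mul_le_mul_of_nonneg_left ?_ (inv_nonneg.2 hspos.le)
      rw [add_mul]
      exact add_le_add_right this _
    have hmem : (s⁻¹ • (B *ᵥ v), r + ε) ∈ K :=
      ⟨⟨hsimp, ⟨add_nonneg hr.1 hεpos.le, hbound _ _ hsimp hle⟩⟩, hle⟩
    have := hmax hmem
    simp only [Set.mem_ofPred_eq] at this
    linarith
  exact ⟨r, v, pos_of_eigenvector hM hv.1 heig hx₀, heig⟩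

/-- The eigenvalue of a positive eigenvector is the spectral radius: for a complex eigenvector `z`,
compare `|z|` with `v` at a maximum of `|z| / v`. -/
lemma matrixSpectralRadius_eq [Nonempty S] (hM : M.IsIrreducible) {v : S → ℝ} (hv : ∀ x, 0 < v x)
    {r : ℝ} (h : M *ᵥ v = r • v) : matrixSpectralRadius M = r := by
  have hr : 0 < r := eigenvalue_pos hM hv h
  have hmem : ∀ μ : ℂ, μ ∈ spectrum ℂ (M.map (algebraMap ℝ ℂ)) ↔
      ∃ z : S → ℂ, z ≠ 0 ∧ M.map (algebraMap ℝ ℂ) *ᵥ z = μ • z := by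
    intro μ
    rw [← Matrix.spectrum_toLin', ← Module.End.hasEigenvalue_iff_mem_spectrum]
    constructor
    · intro hμ
      obtain ⟨z, hz⟩ := hμ.exists_hasEigenvector
      exact ⟨z, hz.2, by simpa using hz.apply_eq_smul⟩
    · rintro ⟨z, hz0, hz⟩
      exact Module.End.hasEigenvalue_of_hasEigenvector
        (Module.End.hasEigenvector_iff.2 ⟨Module.End.mem_eigenspace_iff.2 (by simpa using hz), hz0⟩)
  have hle : ∀ μ ∈ spectrum ℂ (M.map (algebraMap ℝ ℂ)), ‖μ‖ ≤ r := by
    intro μ hμ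
    obtain ⟨z, hz0, hz⟩ := (hmem μ).1 hμ
    obtain ⟨x₀, hx₀⟩ := Finite.exists_max (fun x => ‖z x‖ / v x)
    set t := ‖z x₀‖ / v x₀ with ht
    have hzt : ∀ x, ‖z x‖ ≤ t * v x := fun x => (div_le_iff₀ (hv x)).1 (hx₀ x)
    have hzx₀ : ‖z x₀‖ = t * v x₀ := by rw [ht, div_mul_cancel₀ _ (hv x₀).ne']
    obtain ⟨x₁, hx₁⟩ : ∃ x, z x ≠ 0 := by
      by_contra! hall
      exact hz0 (funext hall)
    have htpos : 0 < t := (div_pos (norm_pos_iff.2 hx₁) (hv x₁)).trans_le (hx₀ x₁)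
    have hkey : ‖μ‖ * (t * v x₀) ≤ r * (t * v x₀) := by
      calc ‖μ‖ * (t * v x₀) = ‖(μ • z) x₀‖ := by
            rw [Pi.smul_apply, norm_smul, hzx₀]
        _ = ‖∑ y, (M x₀ y : ℂ) * z y‖ := by rw [← hz]; rfl
        _ ≤ ∑ y, ‖(M x₀ y : ℂ) * z y‖ := norm_sum_le _ _
        _ ≤ ∑ y, M x₀ y * (t * v y) := by
            refine Finset.sum_le_sum fun y _ => ?_
            rw [norm_mul, Complex.norm_real, Real.norm_of_nonneg (hM.nonneg x₀ y)]
            exact mul_le_mul_of_nonneg_left (hzt y) (hM.nonneg x₀ y)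
        _ = t * (M *ᵥ v) x₀ := by
            rw [mulVec_apply, Finset.mul_sum]
            exact Finset.sum_congr rfl fun y _ => by ring
        _ = r * (t * v x₀) := by rw [h, Pi.smul_apply, smul_eq_mul]; ring
    exact le_of_mul_le_mul_right hkey (mul_pos htpos (hv x₀))
  have hrmem : (r : ℂ) ∈ spectrum ℂ (M.map (algebraMap ℝ ℂ)) := by
    obtain ⟨x₀⟩ := ‹Nonempty S›
    refine (hmem r).2 ⟨fun x => (v x : ℂ), fun h0 => ?_, funext fun x => ?_⟩
    · exact (hv x₀).ne' (by simpa using congrFun h0 x₀)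
    · have := congrFun h x
      rw [mulVec_apply, Pi.smul_apply, smul_eq_mul] at this
      simp only [Matrix.mulVec, dotProduct, Matrix.map_apply, Pi.smul_apply, smul_eq_mul,
        Complex.coe_algebraMap]
      exact_mod_cast this
  have hsr : spectralRadius ℂ (M.map (algebraMap ℝ ℂ)) = ENNReal.ofReal r := by
    refine le_antisymm (iSup₂_le fun μ hμ => ?_) ?_
    · rw [← enorm_eq_nnnorm, ← ofReal_norm]
      exact ENNReal.ofReal_le_ofReal (hle μ hμ)
    · refine le_trans (le_of_eq ?_) (le_iSup₂ (f := fun (k : ℂ) _ => (‖k‖₊ : ENNReal)) _ hrmem)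
      rw [← enorm_eq_nnnorm, ← ofReal_norm, Complex.norm_real, Real.norm_of_nonneg hr.le]
  rw [matrixSpectralRadius, hsr, ENNReal.toReal_ofReal hr.le]

/-- A positive right eigenvector has a positive left eigenvector for the same eigenvalue: evaluate
`uᵀ M v` in two ways. -/
lemma exists_pos_left_eigenvector [Nonempty S] (hM : M.IsIrreducible) {v : S → ℝ}
    (hv : ∀ x, 0 < v x) {r : ℝ} (h : M *ᵥ v = r • v) :
    ∃ u : S → ℝ, (∀ x, 0 < u x) ∧ u ᵥ* M = r • u := by
  obtain ⟨r', u, hu, hMu⟩ := exists_pos_eigenvector hM.transpose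
  rw [Matrix.mulVec_transpose] at hMu
  have huv : 0 < u ⬝ᵥ v := Finset.sum_pos (fun x _ => mul_pos (hu x) (hv x))
    Finset.univ_nonempty
  have h1 : u ⬝ᵥ (M *ᵥ v) = (u ᵥ* M) ⬝ᵥ v := Matrix.dotProduct_mulVec u M v
  rw [h, hMu, dotProduct_smul, smul_dotProduct, smul_eq_mul, smul_eq_mul] at h1
  rw [mul_right_cancel₀ huv.ne' h1]
  exact ⟨u, hu, hMu⟩

/-- Existence and uniqueness of the normalized Perron–Frobenius eigenvectors. -/
lemma existsUnique_perronFrobeniusPair [Nonempty S] (hM : M.IsIrreducible) :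
    ∃! uv : (S → ℝ) × (S → ℝ), IsPerronFrobeniusPair M uv.1 uv.2 := by
  obtain ⟨r, v, hv, hMv⟩ := exists_pos_eigenvector hM
  obtain ⟨u, hu, hMu⟩ := exists_pos_left_eigenvector hM hv hMv
  have hρ := matrixSpectralRadius_eq hM hv hMv
  have hu1 : 0 < ∑ x, u x := Finset.sum_pos (fun x _ => hu x) Finset.univ_nonempty
  set a := (∑ x, u x)⁻¹ with ha
  have hapos : 0 < a := inv_pos.2 hu1
  set c := (∑ x, (a • u) x * v x)⁻¹ with hc
  have hauv : 0 < ∑ x, (a • u) x * v x := Finset.sum_pos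
    (fun x _ => mul_pos (mul_pos hapos (hu x)) (hv x)) Finset.univ_nonempty
  have hcpos : 0 < c := inv_pos.2 hauv
  refine ⟨(a • u, c • v), ⟨fun x => mul_pos hapos (hu x), fun x => mul_pos hcpos (hv x), ?_, ?_,
    ?_, ?_⟩, ?_⟩
  · rw [hρ, Matrix.smul_vecMul, hMu, smul_comm]
  · rw [hρ, Matrix.mulVec_smul, hMv, smul_comm]
  · simp only [Pi.smul_apply, smul_eq_mul, ← Finset.mul_sum]
    exact inv_mul_cancel₀ hu1.ne'
  · calc ∑ x, (a • u) x * (c • v) x = c * ∑ x, (a • u) x * v x := by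
          rw [Finset.mul_sum]
          exact Finset.sum_congr rfl fun x _ => by simp only [Pi.smul_apply, smul_eq_mul]; ring
      _ = 1 := inv_mul_cancel₀ hauv.ne'
  · rintro ⟨u', v'⟩ ⟨hu', hv', hMu', hMv', hsum, hpair⟩
    simp only at hu' hv' hMu' hMv' hsum hpair
    rw [hρ] at hMu' hMv'
    obtain ⟨s, rfl⟩ := eigenvector_unique hM hv hMv hMv'
    obtain ⟨t, rfl⟩ := eigenvector_unique hM.transpose hu (by rwa [Matrix.mulVec_transpose])
      (by rwa [Matrix.mulVec_transpose])
    have ht : t = a := by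
      simp only [Pi.smul_apply, smul_eq_mul, ← Finset.mul_sum] at hsum
      rw [ha]; exact eq_inv_of_mul_eq_one_left hsum
    subst ht
    have hs : s = c := by
      rw [hc]
      refine eq_inv_of_mul_eq_one_left ?_
      rw [← hpair, Finset.mul_sum]
      exact Finset.sum_congr rfl fun x _ => by simp only [Pi.smul_apply, smul_eq_mul]; ring
    rw [hs]

lemma isPerronFrobeniusPair_perronFrobeniusPair [Nonempty S] (hM : M.IsIrreducible) :
    IsPerronFrobeniusPair M (perronFrobeniusPair M).1 (perronFrobeniusPair M).2 :=
  Classical.epsilon_spec (p := fun uv : (S → ℝ) × (S → ℝ) => IsPerronFrobeniusPair M uv.1 uv.2)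
    (existsUnique_perronFrobeniusPair hM).exists

lemma rightEigenvector_pos [Nonempty S] (hM : M.IsIrreducible) (x : S) :
    0 < rightEigenvector M x :=
  (isPerronFrobeniusPair_perronFrobeniusPair hM).right_pos x

lemma mulVec_rightEigenvector [Nonempty S] (hM : M.IsIrreducible) :
    M *ᵥ rightEigenvector M = matrixSpectralRadius M • rightEigenvector M :=
  (isPerronFrobeniusPair_perronFrobeniusPair hM).right_eigen

/-- Ratios of entries of the Perron–Frobenius eigenvector may be read off from any positive
eigenvector. -/
lemma rightEigenvector_div [Nonempty S] (hM : M.IsIrreducible) {v : S → ℝ} (hv : ∀ x, 0 < v x)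
    {r : ℝ} (h : M *ᵥ v = r • v) (x y : S) :
    rightEigenvector M x / rightEigenvector M y = v x / v y := by
  have h1 := mulVec_rightEigenvector hM
  rw [matrixSpectralRadius_eq hM hv h] at h1
  obtain ⟨t, ht⟩ := eigenvector_unique hM hv h h1
  have ht0 : t ≠ 0 := by
    rintro rfl
    have := rightEigenvector_pos hM x
    simp [ht] at this
  rw [ht, Pi.smul_apply, Pi.smul_apply, smul_eq_mul, smul_eq_mul, mul_div_mul_left _ _ ht0]

end

section

/-! ### Differentiability of the Perron–Frobenius eigenvector -/

open Filter Topology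

variable {S : Type*} [Fintype S] [DecidableEq S]

/-- A family of irreducible matrices that depends `C¹` on a parameter has, locally, a differentiable
positive eigenvector. This is the implicit function theorem for
`(θ, w, r) ↦ (A θ w - r w, w y₀ - 1)`, whose partial derivative in `(w, r)` is injective because the
Perron–Frobenius eigenvalue is simple. -/
lemma exists_differentiableAt_eigenvector [Nonempty S] {A : ℝ → Matrix S S ℝ}
    (hA : ∀ x y, ContDiff ℝ 1 fun θ => A θ x y) (hirr : ∀ θ, (A θ).IsIrreducible) (θ₀ : ℝ) :
    ∃ (w : ℝ → S → ℝ) (r : ℝ → ℝ), DifferentiableAt ℝ w θ₀ ∧ DifferentiableAt ℝ r θ₀ ∧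
      ∀ᶠ θ in 𝓝 θ₀, (∀ x, 0 < w θ x) ∧ A θ *ᵥ w θ = r θ • w θ := by
  obtain ⟨r₀, v₀, hv₀, hAv₀⟩ := exists_pos_eigenvector (hirr θ₀)
  let y₀ : S := Classical.arbitrary S
  obtain ⟨v, hv, hAv, hvy⟩ : ∃ v : S → ℝ, (∀ x, 0 < v x) ∧ A θ₀ *ᵥ v = r₀ • v ∧ v y₀ = 1 :=
    ⟨(v₀ y₀)⁻¹ • v₀, fun x => mul_pos (inv_pos.2 (hv₀ y₀)) (hv₀ x),
      by rw [Matrix.mulVec_smul, hAv₀, smul_comm], inv_mul_cancel₀ (hv₀ y₀).ne'⟩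
  obtain ⟨u, hu, huA⟩ := exists_pos_left_eigenvector (hirr θ₀) hv hAv
  let F : ℝ × ((S → ℝ) × ℝ) → (S → ℝ) × ℝ := fun p =>
    (fun x => ∑ y, A p.1 x y * p.2.1 y - p.2.2 * p.2.1 x, p.2.1 y₀ - 1)
  have hF : ContDiff ℝ 1 F := by
    have hA' : ∀ x y, ContDiff ℝ 1 fun p : ℝ × ((S → ℝ) × ℝ) => A p.1 x y := fun x y =>
      (hA x y).comp contDiff_fst
    refine ContDiff.prodMk (contDiff_pi.2 fun x => ?_) (by fun_prop)
    refine ContDiff.sub (ContDiff.sum fun y _ => (hA' x y).mul (by fun_prop)) (by fun_prop)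
  have hFd : HasStrictFDerivAt F (fderiv ℝ F (θ₀, (v, r₀))) (θ₀, (v, r₀)) :=
    hF.contDiffAt.hasStrictFDerivAt one_ne_zero
  set F' := fderiv ℝ F (θ₀, (v, r₀)) ∘L .inr ℝ ℝ ((S → ℝ) × ℝ) with hF'
  have hF'apply : ∀ h s, F' (h, s) = (A θ₀ *ᵥ h - s • v - r₀ • h, h y₀) := by
    intro h s
    -- The partial derivative is computed along the line `t ↦ (θ₀, v + t h, r₀ + t s)`.
    have hline : HasDerivAt (fun t : ℝ => ((θ₀, (v + t • h, r₀ + t • s)) : ℝ × ((S → ℝ) × ℝ)))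
        (0, (h, s)) 0 := by
      refine (hasDerivAt_const _ _).prodMk (HasDerivAt.prodMk ?_ ?_)
      · simpa using ((hasDerivAt_id (0 : ℝ)).smul_const h).const_add v
      · simpa using ((hasDerivAt_id (0 : ℝ)).smul_const s).const_add r₀
    have h1 : HasDerivAt (fun t : ℝ => F (θ₀, (v + t • h, r₀ + t • s))) (F' (h, s)) 0 := by
      have h0 : HasFDerivAt F (fderiv ℝ F (θ₀, (v, r₀)))
          ((fun t : ℝ => ((θ₀, (v + t • h, r₀ + t • s)) : ℝ × ((S → ℝ) × ℝ))) 0) := by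
        simpa using hFd.hasFDerivAt
      have hval : F' (h, s) = fderiv ℝ F (θ₀, (v, r₀)) (0, (h, s)) := by simp [hF']
      rw [hval]
      exact h0.comp_hasDerivAt (0 : ℝ) hline
    have h2 : HasDerivAt (fun t : ℝ => F (θ₀, (v + t • h, r₀ + t • s)))
        (A θ₀ *ᵥ h - s • v - r₀ • h, h y₀) 0 := by
      refine HasDerivAt.prodMk (hasDerivAt_pi.2 fun x => ?_) ?_
      · have hc : ∀ y, HasDerivAt (fun t : ℝ => v y + t * h y) (h y) 0 := fun y => by
          simpa using ((hasDerivAt_id (0 : ℝ)).mul_const (h y)).const_add (v y)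
        have hr : HasDerivAt (fun t : ℝ => r₀ + t * s) s 0 := by
          simpa using ((hasDerivAt_id (0 : ℝ)).mul_const s).const_add r₀
        have := (HasDerivAt.fun_sum (u := Finset.univ) fun y _ =>
          (hc y).const_mul (A θ₀ x y)).sub (hr.mul (hc x))
        refine this.congr_deriv ?_
        simp [mulVec_apply]
        ring
      · simpa using (((hasDerivAt_id (0 : ℝ)).mul_const (h y₀)).const_add (v y₀)).sub_const 1
    exact h1.unique h2
  have hinj : Function.Injective F'.toLinearMap := by
    refine (injective_iff_map_eq_zero _).2 ?_
    rintro ⟨h, s⟩ h0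
    have h0' : F' (h, s) = 0 := h0
    rw [hF'apply, Prod.mk_eq_zero] at h0'
    obtain ⟨h1, h2⟩ := h0'
    have h3 : A θ₀ *ᵥ h = s • v + r₀ • h := by
      rw [sub_sub, sub_eq_zero] at h1; exact h1
    have huv : 0 < u ⬝ᵥ v := Finset.sum_pos (fun x _ => mul_pos (hu x) (hv x))
      Finset.univ_nonempty
    have hs : s = 0 := by
      have h4 := Matrix.dotProduct_mulVec u (A θ₀) h
      rw [h3, huA, dotProduct_add, dotProduct_smul, dotProduct_smul, smul_dotProduct] at h4
      simp only [smul_eq_mul] at h4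
      have h5 : s * (u ⬝ᵥ v) = 0 := by linarith
      exact (mul_eq_zero.1 h5).resolve_right huv.ne'
    subst hs
    rw [zero_smul, zero_add] at h3
    obtain ⟨t, rfl⟩ := eigenvector_unique (hirr θ₀) hv hAv h3
    have ht : t = 0 := by simpa [hvy] using h2
    simp [ht]
  have hinv : F'.IsInvertible :=
    ⟨(LinearEquiv.ofInjectiveEndo F'.toLinearMap hinj).toContinuousLinearEquiv, by ext <;> rfl⟩
  set ψ := hFd.implicitFunctionOfProdDomain hinv
  have hψd : DifferentiableAt ℝ ψ θ₀ :=
    (hFd.hasStrictFDerivAt_implicitFunctionOfProdDomain hinv).hasFDerivAt.differentiableAt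
  have hψt : Tendsto ψ (𝓝 θ₀) (𝓝 (v, r₀)) := hFd.tendsto_implicitFunctionOfProdDomain hinv
  have hψe : ∀ᶠ θ in 𝓝 θ₀, F (θ, ψ θ) = F (θ₀, (v, r₀)) :=
    hFd.eventually_apply_implicitFunctionOfProdDomain hinv
  have hF0 : F (θ₀, (v, r₀)) = 0 := by
    refine Prod.ext (funext fun x => ?_) ?_
    · have := congrFun hAv x
      simp only [mulVec_apply, Pi.smul_apply, smul_eq_mul] at this
      simp [F, this]
    · simp [F, hvy]
  refine ⟨fun θ => (ψ θ).1, fun θ => (ψ θ).2, hψd.fst, hψd.snd, ?_⟩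
  have hpos : ∀ᶠ θ in 𝓝 θ₀, ∀ x, 0 < (ψ θ).1 x := eventually_all.2 fun x =>
    (((continuous_apply x).comp continuous_fst).tendsto _ |>.comp hψt).eventually
      (lt_mem_nhds (hv x))
  filter_upwards [hpos, hψe] with θ h1 h2
  refine ⟨h1, funext fun x => ?_⟩
  rw [hF0] at h2
  have := congrFun (congrArg Prod.fst h2) x
  simp only [mulVec_apply, Pi.smul_apply, smul_eq_mul]
  exact sub_eq_zero.1 this

end

section

/-! ### The tilted matrices -/

variable {S : Type*} [Fintype S] [Nonempty S] {P : Matrix S S ℝ} {f : S → ℝ}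

lemma scaledTilt_apply (P : Matrix S S ℝ) (f : S → ℝ) (θ : ℝ) (x y : S) :
    scaledTilt P f θ x y = P x y * Real.exp (θ * (f y - maxValue f)) := by
  simp only [scaledTilt, tilt, Matrix.smul_apply, Matrix.of_apply, smul_eq_mul]
  rw [mul_left_comm, ← Real.exp_add]
  ring_nf

lemma le_maxValue (f : S → ℝ) (x : S) : f x ≤ maxValue f :=
  Finset.le_sup' f (Finset.mem_univ x)

lemma exists_mem_maxSet (f : S → ℝ) : ∃ x, x ∈ maxSet f := by
  obtain ⟨x, -, hx⟩ := Finset.exists_mem_eq_sup' Finset.univ_nonempty f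
  exact ⟨x, hx.symm⟩

lemma scaledTilt_apply_of_mem_maxSet (P : Matrix S S ℝ) (θ : ℝ) (x : S) {y : S}
    (hy : y ∈ maxSet f) : scaledTilt P f θ x y = P x y := by
  rw [scaledTilt_apply, show f y = maxValue f from hy, sub_self, mul_zero, Real.exp_zero, mul_one]

lemma scaledTilt_le (hP : ∀ x y, 0 ≤ P x y) {θ : ℝ} (hθ : 0 ≤ θ) (x y : S) :
    scaledTilt P f θ x y ≤ P x y := by
  rw [scaledTilt_apply]
  exact mul_le_of_le_one_right (hP x y)
    (Real.exp_le_one_iff.2 (mul_nonpos_of_nonneg_of_nonpos hθ (sub_nonpos.2 (le_maxValue f y))))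

lemma isIrreducible_scaledTilt (hP : P.IsIrreducible) (f : S → ℝ) (θ : ℝ) :
    (scaledTilt P f θ).IsIrreducible := by
  refine isIrreducible_of_pos_of_pos hP (fun x y => ?_) fun x y h => ?_
  · rw [scaledTilt_apply]; exact mul_nonneg (hP.nonneg x y) (Real.exp_pos _).le
  · rw [scaledTilt_apply]; exact mul_pos h (Real.exp_pos _)

lemma hasDerivAt_scaledTilt_apply (P : Matrix S S ℝ) (f : S → ℝ) (θ : ℝ) (x y : S) :
    HasDerivAt (fun θ => scaledTilt P f θ x y)
      (scaledTilt P f θ x y * (f y - maxValue f)) θ := by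
  simp only [scaledTilt_apply]
  have := (((hasDerivAt_id θ).mul_const (f y - maxValue f)).exp).const_mul (P x y)
  refine this.congr_deriv ?_
  simp only [id_eq]
  ring

lemma contDiff_scaledTilt_apply (P : Matrix S S ℝ) (f : S → ℝ) (x y : S) :
    ContDiff ℝ 1 fun θ => scaledTilt P f θ x y := by
  simp only [scaledTilt_apply]
  fun_prop

/-- For `θ ≥ 0` the tilted matrix is substochastic, so the eigenvalue is at most `1`. -/
lemma eigenvalue_scaledTilt_le_one (hP : ∀ x y, 0 ≤ P x y) (hsum : ∀ x, ∑ y, P x y = 1) {θ : ℝ}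
    (hθ : 0 ≤ θ) {v : S → ℝ} (hv : ∀ x, 0 < v x) {r : ℝ} (h : scaledTilt P f θ *ᵥ v = r • v) :
    r ≤ 1 := by
  obtain ⟨x, hx⟩ := Finite.exists_max v
  refine le_of_mul_le_mul_right ?_ (hv x)
  calc r * v x = ∑ y, scaledTilt P f θ x y * v y := by
        rw [← mulVec_apply, h, Pi.smul_apply, smul_eq_mul]
    _ ≤ ∑ y, P x y * v x := Finset.sum_le_sum fun y _ =>
        mul_le_mul (scaledTilt_le hP hθ x y) (hx y) (hv y).le (hP x y)
    _ = 1 * v x := by rw [← Finset.sum_mul, hsum]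

/-- The block on the maximizing states does not depend on `θ`, which bounds the eigenvalue below. -/
lemma exists_pos_le_eigenvalue (hP : P.IsIrreducible)
    (hA1 : (P.submatrix (fun i : maxSet f => (i : S))
      (fun j : maxSet f => (j : S))).IsIrreducible) :
    ∃ p > 0, ∀ (θ : ℝ) (v : S → ℝ) (r : ℝ), (∀ x, 0 < v x) → scaledTilt P f θ *ᵥ v = r • v →
      p ≤ r := by
  obtain ⟨x₀, hx₀⟩ := exists_mem_maxSet f
  have : Nonempty (maxSet f) := ⟨⟨x₀, hx₀⟩⟩
  choose s hs using exists_pos_of_isIrreducible hA1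
  simp only [Matrix.submatrix_apply] at hs
  obtain ⟨a, ha⟩ := Finite.exists_min fun x : maxSet f => P x (s x)
  refine ⟨P a (s a), hs a, fun θ v r hv h => ?_⟩
  obtain ⟨x, hx⟩ := Finite.exists_min fun x : maxSet f => v x
  have h1 := mul_le_mulVec_apply (isIrreducible_scaledTilt hP f θ).nonneg (fun y => (hv y).le)
    (x : S) (s x)
  rw [h, Pi.smul_apply, smul_eq_mul, scaledTilt_apply_of_mem_maxSet P θ _ (s x).2] at h1
  exact le_of_mul_le_mul_right
    ((mul_le_mul (ha x) (hx (s x)) (hv x).le (hs x).le).trans h1) (hv x)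

/-! ### Uniform bounds on the ratios -/

/-- Comparability of entries, uniform over a set `T` of vectors, passes along the paths of an
irreducible matrix. -/
lemma exists_le_mul_of_isIrreducible {n α : Type*} {B : Matrix n n ℝ} (hB : B.IsIrreducible)
    (φ : n → α) (T : Set (α → ℝ))
    (hedge : ∀ a b, 0 < B a b → ∃ C, 0 ≤ C ∧ ∀ v ∈ T, v (φ b) ≤ C * v (φ a)) (a b : n) :
    ∃ C, 0 ≤ C ∧ ∀ v ∈ T, v (φ b) ≤ C * v (φ a) := by
  refine forall_of_isIrreducible_reverse hB
    (C := fun a => ∃ C, 0 ≤ C ∧ ∀ v ∈ T, v (φ b) ≤ C * v (φ a)) b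
    ⟨1, zero_le_one, fun v _ => (one_mul _).ge⟩ (fun c d hcd => ?_) a
  rintro ⟨C, hC, h⟩
  obtain ⟨C', hC', h'⟩ := hedge c d hcd
  refine ⟨C * C', mul_nonneg hC hC', fun v hv => (h v hv).trans ?_⟩
  rw [mul_assoc]
  exact mul_le_mul_of_nonneg_left (h' v hv) hC

/-- The positive eigenvectors of the matrices `P̄_θ` for `θ ∈ Θ`. -/
def positiveEigenvectors (P : Matrix S S ℝ) (f : S → ℝ) (Θ : Set ℝ) : Set (S → ℝ) :=
  {v | (∀ x, 0 < v x) ∧ ∃ θ ∈ Θ, ∃ r : ℝ, scaledTilt P f θ *ᵥ v = r • v}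

/-- The entries at maximizing states are dominated by all entries, as the columns of `P̄_θ` at
maximizing states do not depend on `θ`. -/
lemma exists_le_mul_of_mem_maxSet (hP : P.IsIrreducible) (hsum : ∀ x, ∑ y, P x y = 1)
    (hA1 : (P.submatrix (fun i : maxSet f => (i : S))
      (fun j : maxSet f => (j : S))).IsIrreducible)
    (hA2 : ∀ x, x ∉ maxSet f → ∃ y ∈ maxSet f, 0 < P x y) :
    ∃ C, 0 < C ∧ ∀ v ∈ positiveEigenvectors P f (Set.Ici 0), ∀ x, ∀ y ∈ maxSet f,
      v y ≤ C * v x := by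
  have hedge : ∀ x, ∀ y ∈ maxSet f, 0 < P x y → ∃ C, 0 ≤ C ∧
      ∀ v ∈ positiveEigenvectors P f (Set.Ici 0), v y ≤ C * v x := by
    intro x y hy hxy
    refine ⟨(P x y)⁻¹, (inv_pos.2 hxy).le, ?_⟩
    rintro v ⟨hv, θ, hθ, r, h⟩
    rw [le_inv_mul_iff₀ hxy]
    have h1 := mul_le_mulVec_apply (isIrreducible_scaledTilt hP f θ).nonneg (fun y => (hv y).le)
      x y
    rw [h, Pi.smul_apply, smul_eq_mul, scaledTilt_apply_of_mem_maxSet P θ _ hy] at h1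
    exact h1.trans (mul_le_of_le_one_left (hv x).le
      (eigenvalue_scaledTilt_le_one hP.nonneg hsum hθ hv h))
  have hmax : ∀ x y : maxSet f, ∃ C, 0 ≤ C ∧
      ∀ v ∈ positiveEigenvectors P f (Set.Ici 0), v y ≤ C * v x :=
    exists_le_mul_of_isIrreducible hA1 (fun x => (x : S)) _ fun a b hab => hedge a b b.2 hab
  have hall : ∀ (x : S) (y : maxSet f), ∃ C, 0 ≤ C ∧
      ∀ v ∈ positiveEigenvectors P f (Set.Ici 0), v y ≤ C * v x := by
    intro x y
    by_cases hx : x ∈ maxSet f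
    · exact hmax ⟨x, hx⟩ y
    · obtain ⟨z, hz, hxz⟩ := hA2 x hx
      obtain ⟨C, hC, h⟩ := hedge x z hz hxz
      obtain ⟨C', hC', h'⟩ := hmax ⟨z, hz⟩ y
      refine ⟨C' * C, mul_nonneg hC' hC, fun v hv => (h' v hv).trans ?_⟩
      rw [mul_assoc]
      exact mul_le_mul_of_nonneg_left (h v hv) hC'
  choose C hC h using hall
  obtain ⟨D, hD⟩ := (Set.finite_range fun p : S × maxSet f => C p.1 p.2).bddAbove
  refine ⟨max D 1, lt_max_of_lt_right one_pos, fun v hv x y hy => (h x ⟨y, hy⟩ v hv).trans ?_⟩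
  exact mul_le_mul_of_nonneg_right ((hD ⟨(x, ⟨y, hy⟩), rfl⟩).trans (le_max_left _ _)) (hv.1 x).le

/-- On a bounded range of `θ` the positive entries of `P̄_θ` are bounded below, so irreducibility of
`P` bounds the ratios. -/
lemma exists_le_mul_of_bounded (hP : P.IsIrreducible) (hsum : ∀ x, ∑ y, P x y = 1) (θ₁ : ℝ) :
    ∃ C, ∀ v ∈ positiveEigenvectors P f (Set.Icc 0 θ₁), ∀ x y, v y ≤ C * v x := by
  have hall : ∀ x y, ∃ C, 0 ≤ C ∧
      ∀ v ∈ positiveEigenvectors P f (Set.Icc 0 θ₁), v y ≤ C * v x := by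
    refine exists_le_mul_of_isIrreducible hP id _ fun x y hxy => ?_
    set p := P x y * Real.exp (θ₁ * (f y - maxValue f))
    have hp : 0 < p := mul_pos hxy (Real.exp_pos _)
    refine ⟨p⁻¹, (inv_pos.2 hp).le, ?_⟩
    rintro v ⟨hv, θ, hθ, r, h⟩
    rw [le_inv_mul_iff₀ hp, id, id]
    have h1 := mul_le_mulVec_apply (isIrreducible_scaledTilt hP f θ).nonneg (fun y => (hv y).le)
      x y
    rw [h, Pi.smul_apply, smul_eq_mul, scaledTilt_apply] at h1
    have h2 : p ≤ P x y * Real.exp (θ * (f y - maxValue f)) :=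
      mul_le_mul_of_nonneg_left (Real.exp_le_exp.2
        (mul_le_mul_of_nonpos_right hθ.2 (sub_nonpos.2 (le_maxValue f y)))) hxy.le
    exact ((mul_le_mul_of_nonneg_right h2 (hv y).le).trans h1).trans
      (mul_le_of_le_one_left (hv x).le (eigenvalue_scaledTilt_le_one hP.nonneg hsum hθ.1 hv h))
  choose C hC h using hall
  obtain ⟨D, hD⟩ := (Set.finite_range fun p : S × S => C p.1 p.2).bddAbove
  exact ⟨D, fun v hv x y => (h x y v hv).trans
    (mul_le_mul_of_nonneg_right (hD ⟨(x, y), rfl⟩) (hv.1 x).le)⟩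

/-- For large `θ` the columns of `P̄_θ` at non-maximizing states are small compared with the
eigenvalue, so a non-maximizing state cannot carry an entry much larger than those at the maximizing
states. -/
lemma exists_le_mul_of_large (hP : P.IsIrreducible) (hsum : ∀ x, ∑ y, P x y = 1)
    (hA1 : (P.submatrix (fun i : maxSet f => (i : S))
      (fun j : maxSet f => (j : S))).IsIrreducible)
    (hA2 : ∀ x, x ∉ maxSet f → ∃ y ∈ maxSet f, 0 < P x y) :
    ∃ θ₁ C : ℝ, ∀ v ∈ positiveEigenvectors P f (Set.Ici 0 ∩ Set.Ici θ₁), ∀ x y,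
      v y ≤ C * v x := by
  obtain ⟨C, hC, hCle⟩ := exists_le_mul_of_mem_maxSet hP hsum hA1 hA2
  obtain ⟨p, hp, hple⟩ := exists_pos_le_eigenvalue hP hA1
  have hθ : ∃ θ₁ : ℝ, ∀ θ ≥ θ₁, ∀ y, y ∉ maxSet f → Real.exp (θ * (f y - maxValue f)) ≤ p / 2 := by
    have : ∀ y, y ∉ maxSet f → ∀ᶠ θ : ℝ in Filter.atTop,
        Real.exp (θ * (f y - maxValue f)) ≤ p / 2 := by
      intro y hy
      have hlt : f y - maxValue f < 0 := sub_neg.2 ((le_maxValue f y).lt_of_ne hy)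
      have ht := Real.tendsto_exp_atBot.comp
        (Filter.Tendsto.atTop_mul_const_of_neg hlt Filter.tendsto_id)
      exact (ht.eventually (ge_mem_nhds (half_pos hp)))
    exact Filter.eventually_atTop.1 (Filter.eventually_all.2 fun y =>
      Filter.eventually_imp_distrib_left.2 (this y))
  obtain ⟨θ₁, hθ₁⟩ := hθ
  obtain ⟨y₀, hy₀⟩ := exists_mem_maxSet f
  have : Nonempty (maxSet f) := ⟨⟨y₀, hy₀⟩⟩
  refine ⟨θ₁, (p / 2)⁻¹ * C, ?_⟩
  rintro v ⟨hv, θ, ⟨hθ0, hθ⟩, r, h⟩ x y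
  have hvmem : v ∈ positiveEigenvectors P f (Set.Ici 0) := ⟨hv, θ, hθ0, r, h⟩
  obtain ⟨x₀, hx₀⟩ := Finite.exists_max v
  obtain ⟨m, hm⟩ := Finite.exists_max fun y : maxSet f => v y
  have hkey : r * v x₀ ≤ v m + p / 2 * v x₀ := by
    calc r * v x₀ = ∑ y, scaledTilt P f θ x₀ y * v y := by
          rw [← mulVec_apply, h, Pi.smul_apply, smul_eq_mul]
      _ ≤ ∑ y, P x₀ y * (v m + p / 2 * v x₀) := by
          refine Finset.sum_le_sum fun y _ => ?_
          have h0 := mul_pos (half_pos hp) (hv x₀)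
          by_cases hy : y ∈ maxSet f
          · rw [scaledTilt_apply_of_mem_maxSet P θ x₀ hy]
            exact mul_le_mul_of_nonneg_left (by linarith [hm ⟨y, hy⟩]) (hP.nonneg _ _)
          · rw [scaledTilt_apply, mul_assoc]
            refine mul_le_mul_of_nonneg_left ?_ (hP.nonneg _ _)
            have := mul_le_mul (hθ₁ θ hθ y hy) (hx₀ y) (hv y).le (half_pos hp).le
            linarith [hv m]
      _ = v m + p / 2 * v x₀ := by rw [← Finset.sum_mul, hsum, one_mul]
  have h1 : p * v x₀ ≤ r * v x₀ := mul_le_mul_of_nonneg_right (hple θ v r hv h) (hv x₀).le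
  have h2 : v x₀ ≤ (p / 2)⁻¹ * v m := by
    rw [le_inv_mul_iff₀ (half_pos hp)]
    linarith
  calc v y ≤ (p / 2)⁻¹ * v m := (hx₀ y).trans h2
    _ ≤ (p / 2)⁻¹ * (C * v x) := mul_le_mul_of_nonneg_left (hCle v hvmem x m m.2)
        (inv_pos.2 (half_pos hp)).le
    _ = _ := (mul_assoc _ _ _).symm

/-- The ratios of the entries of the eigenvectors are bounded, uniformly in `θ ≥ 0`. -/
lemma exists_le_mul (hP : P.IsIrreducible) (hsum : ∀ x, ∑ y, P x y = 1)
    (hA1 : (P.submatrix (fun i : maxSet f => (i : S))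
      (fun j : maxSet f => (j : S))).IsIrreducible)
    (hA2 : ∀ x, x ∉ maxSet f → ∃ y ∈ maxSet f, 0 < P x y) :
    ∃ K, 0 < K ∧ ∀ v ∈ positiveEigenvectors P f (Set.Ici 0), ∀ x y, v y ≤ K * v x := by
  obtain ⟨θ₁, C₁, h₁⟩ := exists_le_mul_of_large hP hsum hA1 hA2
  obtain ⟨C₂, h₂⟩ := exists_le_mul_of_bounded (f := f) hP hsum θ₁
  refine ⟨max (max C₁ C₂) 1, lt_max_of_lt_right one_pos, ?_⟩
  rintro v ⟨hv, θ, hθ, r, h⟩ x y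
  rcases le_total θ₁ θ with hle | hle
  · refine (h₁ v ⟨hv, θ, ⟨hθ, hle⟩, r, h⟩ x y).trans (mul_le_mul_of_nonneg_right ?_ (hv x).le)
    exact (le_max_left _ _).trans (le_max_left _ _)
  · refine (h₂ v ⟨hv, θ, ⟨hθ, hle⟩, r, h⟩ x y).trans (mul_le_mul_of_nonneg_right ?_ (hv x).le)
    exact (le_max_right _ _).trans (le_max_left _ _)

/-! ### Uniform bounds on the derivatives -/

/-- Bounds on functions that vanish somewhere pass along the edges that enter `maxSet f`. -/
lemma exists_bound_of_edge_bound
    (hA1 : (P.submatrix (fun i : maxSet f => (i : S))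
      (fun j : maxSet f => (j : S))).IsIrreducible)
    (hA2 : ∀ x, x ∉ maxSet f → ∃ y ∈ maxSet f, 0 < P x y) {K : ℝ} (hK : 0 < K) (C : ℝ) {y₀ : S}
    (hy₀ : y₀ ∈ maxSet f) :
    ∃ B, ∀ D : S → ℝ, (∃ x, D x = 0) →
      (∀ x, ∀ y ∈ maxSet f, 0 < P x y → P x y * D y ≤ K * (D x + C)) → D y₀ ≤ B := by
  have hstep : ∀ x b, ∀ y ∈ maxSet f, 0 < P x y → ∃ B, ∀ D : S → ℝ, D x ≤ b →
      (∀ x, ∀ y ∈ maxSet f, 0 < P x y → P x y * D y ≤ K * (D x + C)) → D y ≤ B := by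
    intro x b y hy hxy
    refine ⟨(P x y)⁻¹ * (K * (b + C)), fun D hb hD => ?_⟩
    rw [le_inv_mul_iff₀ hxy]
    exact (hD x y hy hxy).trans (mul_le_mul_of_nonneg_left (by linarith) hK.le)
  have hmax : ∀ x : maxSet f, ∀ b, ∃ B, ∀ D : S → ℝ, D x ≤ b →
      (∀ x, ∀ y ∈ maxSet f, 0 < P x y → P x y * D y ≤ K * (D x + C)) → D y₀ ≤ B := by
    refine forall_of_isIrreducible_reverse hA1 ⟨y₀, hy₀⟩ (fun b => ⟨b, fun D h _ => h⟩) ?_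
    intro x y hxy ih b
    obtain ⟨B, hB⟩ := hstep x b y y.2 hxy
    obtain ⟨B', hB'⟩ := ih B
    exact ⟨B', fun D hb hD => hB' D (hB D hb hD) hD⟩
  have hall : ∀ x, ∃ B, ∀ D : S → ℝ, D x = 0 →
      (∀ x, ∀ y ∈ maxSet f, 0 < P x y → P x y * D y ≤ K * (D x + C)) → D y₀ ≤ B := by
    intro x
    by_cases hx : x ∈ maxSet f
    · obtain ⟨B, hB⟩ := hmax ⟨x, hx⟩ 0
      exact ⟨B, fun D h0 => hB D h0.le⟩
    · obtain ⟨z, hz, hxz⟩ := hA2 x hx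
      obtain ⟨B, hB⟩ := hstep x 0 z hz hxz
      obtain ⟨B', hB'⟩ := hmax ⟨z, hz⟩ B
      exact ⟨B', fun D h0 hD => hB' D (hB D h0.le hD) hD⟩
  choose B hB using hall
  obtain ⟨B', hB'⟩ := (Set.finite_range B).bddAbove
  exact ⟨B', fun D ⟨x, hx⟩ hD => (hB x D hx hD).trans (hB' ⟨x, rfl⟩)⟩

/-- Differentiating the eigenvalue equation and dividing by `v`: the logarithmic derivative `g` of
the eigenvector solves a Poisson equation. -/
lemma sum_logDeriv_eq {θ₀ : ℝ} {w : ℝ → S → ℝ} {r : ℝ → ℝ} (hw : DifferentiableAt ℝ w θ₀)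
    (hr : DifferentiableAt ℝ r θ₀)
    (h : ∀ᶠ θ in nhds θ₀, (∀ x, 0 < w θ x) ∧ scaledTilt P f θ *ᵥ w θ = r θ • w θ) (x : S) :
    ∑ y, scaledTilt P f θ₀ x y * w θ₀ y *
      (deriv w θ₀ y / w θ₀ y - deriv w θ₀ x / w θ₀ x + (f y - maxValue f)) =
      deriv r θ₀ * w θ₀ x := by
  have hpos := h.self_of_nhds.1
  have heq := congrFun h.self_of_nhds.2 x
  rw [mulVec_apply, Pi.smul_apply, smul_eq_mul] at heq
  have hwd : ∀ y, HasDerivAt (fun θ => w θ y) (deriv w θ₀ y) θ₀ :=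
    hasDerivAt_pi.1 hw.hasDerivAt
  have hL : HasDerivAt (fun θ => ∑ y, scaledTilt P f θ x y * w θ y)
      (∑ y, (scaledTilt P f θ₀ x y * (f y - maxValue f) * w θ₀ y +
        scaledTilt P f θ₀ x y * deriv w θ₀ y)) θ₀ :=
    HasDerivAt.fun_sum fun y _ => (hasDerivAt_scaledTilt_apply P f θ₀ x y).mul (hwd y)
  have hR : HasDerivAt (fun θ => r θ * w θ x)
      (deriv r θ₀ * w θ₀ x + r θ₀ * deriv w θ₀ x) θ₀ := hr.hasDerivAt.mul (hwd x)
  have hLR : (fun θ => ∑ y, scaledTilt P f θ x y * w θ y) =ᶠ[nhds θ₀] fun θ => r θ * w θ x :=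
    h.mono fun θ hθ => congrFun hθ.2 x
  have hd := hL.unique (hR.congr_of_eventuallyEq hLR)
  have h1 : ∑ y, scaledTilt P f θ₀ x y * w θ₀ y *
      (deriv w θ₀ y / w θ₀ y - deriv w θ₀ x / w θ₀ x + (f y - maxValue f)) =
      ∑ y, (scaledTilt P f θ₀ x y * (f y - maxValue f) * w θ₀ y +
        scaledTilt P f θ₀ x y * deriv w θ₀ y) -
      (∑ y, scaledTilt P f θ₀ x y * w θ₀ y) * (deriv w θ₀ x / w θ₀ x) := by
    rw [Finset.sum_mul, ← Finset.sum_sub_distrib]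
    refine Finset.sum_congr rfl fun y _ => ?_
    have := (hpos y).ne'
    have := (hpos x).ne'
    field_simp
    ring
  rw [h1, hd, heq]
  have := (hpos x).ne'
  field_simp
  ring

/-- The logarithmic derivative of the eigenvector has oscillation bounded uniformly in `θ ≥ 0`. With
`r` the eigenvalue, the maximum principle for the Poisson equation at a maximum and at a minimum of
`g` gives `-c r ≤ r' ≤ 0`, where `c` bounds `max f - f`; the equation then bounds the distance of `g`
from its extrema along the edges that enter `maxSet f`. -/
lemma exists_logDeriv_sub_le (hP : P.IsIrreducible) (hsum : ∀ x, ∑ y, P x y = 1)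
    (hA1 : (P.submatrix (fun i : maxSet f => (i : S))
      (fun j : maxSet f => (j : S))).IsIrreducible)
    (hA2 : ∀ x, x ∉ maxSet f → ∃ y ∈ maxSet f, 0 < P x y) :
    ∃ B, ∀ (θ₀ : ℝ) (w : ℝ → S → ℝ) (r : ℝ → ℝ), 0 ≤ θ₀ → DifferentiableAt ℝ w θ₀ →
      DifferentiableAt ℝ r θ₀ →
      (∀ᶠ θ in nhds θ₀, (∀ x, 0 < w θ x) ∧ scaledTilt P f θ *ᵥ w θ = r θ • w θ) → ∀ x y,
      |deriv w θ₀ x / w θ₀ x - deriv w θ₀ y / w θ₀ y| ≤ B := by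
  obtain ⟨K, hK, hKle⟩ := exists_le_mul hP hsum hA1 hA2
  obtain ⟨c, hc⟩ := (Set.finite_range fun x => maxValue f - f x).bddAbove
  replace hc : ∀ x, maxValue f - f x ≤ c := fun x => hc ⟨x, rfl⟩
  obtain ⟨y₀, hy₀⟩ := exists_mem_maxSet f
  have hc0 : 0 ≤ c := (sub_nonneg.2 (le_maxValue f y₀)).trans (hc y₀)
  obtain ⟨B, hB⟩ := exists_bound_of_edge_bound hA1 hA2 hK c hy₀
  refine ⟨B + B, fun θ₀ w r hθ₀ hw hr h => ?_⟩
  have hpos := h.self_of_nhds.1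
  have hvec := h.self_of_nhds.2
  have heq : ∀ x, ∑ y, scaledTilt P f θ₀ x y * w θ₀ y = r θ₀ * w θ₀ x := fun x => congrFun hvec x
  have hpoisson := sum_logDeriv_eq hw hr h
  have hr1 := eigenvalue_scaledTilt_le_one hP.nonneg hsum hθ₀ hpos hvec
  have hr0 := eigenvalue_pos (isIrreducible_scaledTilt hP f θ₀) hpos hvec
  have hwK := hKle (w θ₀) ⟨hpos, θ₀, hθ₀, r θ₀, hvec⟩
  have hq : ∀ x y, 0 ≤ scaledTilt P f θ₀ x y * w θ₀ y := fun x y =>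
    mul_nonneg ((isIrreducible_scaledTilt hP f θ₀).nonneg x y) (hpos y).le
  set g : S → ℝ := fun x => deriv w θ₀ x / w θ₀ x with hg
  set q : S → S → ℝ := fun x y => scaledTilt P f θ₀ x y * w θ₀ y with hqdef
  replace hpoisson : ∀ x, ∑ y, q x y * (g y - g x + (f y - maxValue f)) = deriv r θ₀ * w θ₀ x :=
    hpoisson
  have hcost : ∀ x, -(c * (r θ₀ * w θ₀ x)) ≤ ∑ y, q x y * (f y - maxValue f) := by
    intro x
    rw [← heq, Finset.mul_sum, ← Finset.sum_neg_distrib]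
    refine Finset.sum_le_sum fun y _ => ?_
    nlinarith [hq x y, hc y]
  have hcost' : ∀ x, ∑ y, q x y * (f y - maxValue f) ≤ 0 := fun x =>
    Finset.sum_nonpos fun y _ => mul_nonpos_of_nonneg_of_nonpos (hq x y)
      (sub_nonpos.2 (le_maxValue f y))
  have hsplit : ∀ x, ∑ y, q x y * (g y - g x) + ∑ y, q x y * (f y - maxValue f) =
      deriv r θ₀ * w θ₀ x := fun x => by
    rw [← hpoisson, ← Finset.sum_add_distrib]
    exact Finset.sum_congr rfl fun y _ => (mul_add _ _ _).symm
  obtain ⟨xM, hxM⟩ := Finite.exists_max g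
  obtain ⟨xm, hxm⟩ := Finite.exists_min g
  have hr' : deriv r θ₀ ≤ 0 := by
    refine nonpos_of_mul_nonpos_left (b := w θ₀ xM) ?_ (hpos xM)
    rw [← hsplit]
    exact add_nonpos (Finset.sum_nonpos fun y _ => mul_nonpos_of_nonneg_of_nonpos (hq xM y)
      (sub_nonpos.2 (hxM y))) (hcost' xM)
  have hr'' : -(c * r θ₀) ≤ deriv r θ₀ := by
    refine le_of_mul_le_mul_right ?_ (hpos xm)
    rw [← hsplit]
    have : 0 ≤ ∑ y, q xm y * (g y - g xm) :=
      Finset.sum_nonneg fun y _ => mul_nonneg (hq xm y) (sub_nonneg.2 (hxm y))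
    linarith [hcost xm]
  -- Both `max g - g` and `g - min g` satisfy the hypotheses of `exists_bound_of_edge_bound`.
  have hedge : ∀ D : S → ℝ, (∀ x, 0 ≤ D x) →
      (∀ x, ∑ y, q x y * D y ≤ r θ₀ * w θ₀ x * (D x + c)) →
      ∀ x, ∀ y ∈ maxSet f, 0 < P x y → P x y * D y ≤ K * (D x + c) := by
    intro D hD h x y hy hxy
    have h1 : q x y * D y ≤ r θ₀ * w θ₀ x * (D x + c) :=
      (Finset.single_le_sum (f := fun y => q x y * D y) (fun y _ => mul_nonneg (hq x y) (hD y))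
        (Finset.mem_univ y)).trans (h x)
    have h2 : q x y = P x y * w θ₀ y := by
      rw [hqdef]; simp only; rw [scaledTilt_apply_of_mem_maxSet P θ₀ x hy]
    have hDc : 0 ≤ D x + c := add_nonneg (hD x) hc0
    refine le_of_mul_le_mul_right ?_ (hpos y)
    calc P x y * D y * w θ₀ y = q x y * D y := by rw [h2]; ring
      _ ≤ r θ₀ * w θ₀ x * (D x + c) := h1
      _ ≤ 1 * w θ₀ x * (D x + c) := mul_le_mul_of_nonneg_right
          (mul_le_mul_of_nonneg_right hr1 (hpos x).le) hDc
      _ ≤ 1 * (K * w θ₀ y) * (D x + c) := mul_le_mul_of_nonneg_right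
          (mul_le_mul_of_nonneg_left (hwK y x) zero_le_one) hDc
      _ = K * (D x + c) * w θ₀ y := by ring
  have hM : g xM - g y₀ ≤ B := by
    refine hB (fun x => g xM - g x) ⟨xM, sub_self _⟩
      (hedge _ (fun x => sub_nonneg.2 (hxM x)) fun x => ?_)
    have h1 : ∑ y, q x y * (g xM - g y) =
        r θ₀ * w θ₀ x * (g xM - g x) - ∑ y, q x y * (g y - g x) := by
      rw [← heq, Finset.sum_mul, ← Finset.sum_sub_distrib]
      exact Finset.sum_congr rfl fun y _ => by ring
    have h2 := mul_le_mul_of_nonneg_right hr'' (hpos x).le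
    linarith [hsplit x, hcost' x]
  have hm : g y₀ - g xm ≤ B := by
    refine hB (fun x => g x - g xm) ⟨xm, sub_self _⟩
      (hedge _ (fun x => sub_nonneg.2 (hxm x)) fun x => ?_)
    have h1 : ∑ y, q x y * (g y - g xm) =
        r θ₀ * w θ₀ x * (g x - g xm) + ∑ y, q x y * (g y - g x) := by
      rw [← heq, Finset.sum_mul, ← Finset.sum_add_distrib]
      exact Finset.sum_congr rfl fun y _ => by ring
    have h2 := mul_nonpos_of_nonpos_of_nonneg hr' (hpos x).le
    linarith [hsplit x, hcost x]
  intro x y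
  rw [abs_le]
  constructor <;> linarith [hxM x, hxM y, hxm x, hxm y]

end

section

/-! ### The ratios of the Perron–Frobenius eigenvectors -/

variable {S : Type*} [Fintype S] [DecidableEq S] [Nonempty S] {P : Matrix S S ℝ} {f : S → ℝ}

lemma rightEigenvector_mem_positiveEigenvectors (hP : P.IsIrreducible) {θ : ℝ} (hθ : 0 ≤ θ) :
    rightEigenvector (scaledTilt P f θ) ∈ positiveEigenvectors P f (Set.Ici 0) :=
  ⟨rightEigenvector_pos (isIrreducible_scaledTilt hP f θ), θ, hθ, _,
    mulVec_rightEigenvector (isIrreducible_scaledTilt hP f θ)⟩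

lemma evecRatio_pos (hP : P.IsIrreducible) (x y : S) (θ : ℝ) : 0 < evecRatio P f x y θ :=
  div_pos (rightEigenvector_pos (isIrreducible_scaledTilt hP f θ) x)
    (rightEigenvector_pos (isIrreducible_scaledTilt hP f θ) y)

/-- The derivative of a ratio of entries is the ratio times the difference of the logarithmic
derivatives, which may be computed from any differentiable choice of eigenvectors. -/
lemma hasDerivAt_evecRatio (hP : P.IsIrreducible) {θ₀ : ℝ} {w : ℝ → S → ℝ} {r : ℝ → ℝ}
    (hw : DifferentiableAt ℝ w θ₀)
    (h : ∀ᶠ θ in nhds θ₀, (∀ x, 0 < w θ x) ∧ scaledTilt P f θ *ᵥ w θ = r θ • w θ) (x y : S) :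
    HasDerivAt (evecRatio P f x y)
      (evecRatio P f x y θ₀ * (deriv w θ₀ x / w θ₀ x - deriv w θ₀ y / w θ₀ y)) θ₀ := by
  have heq : evecRatio P f x y =ᶠ[nhds θ₀] fun θ => w θ x / w θ y := h.mono fun θ hθ =>
    rightEigenvector_div (isIrreducible_scaledTilt hP f θ) hθ.1 hθ.2 x y
  have hwd := hasDerivAt_pi.1 hw.hasDerivAt
  have hx := (h.self_of_nhds.1 x).ne'
  have hy := (h.self_of_nhds.1 y).ne'
  refine HasDerivAt.congr_of_eventuallyEq ?_ heq
  refine ((hwd x).div (hwd y) hy).congr_deriv ?_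
  rw [heq.self_of_nhds]
  field_simp

lemma exists_differentiableAt_eigenvector_scaledTilt (hP : P.IsIrreducible) (f : S → ℝ)
    (θ₀ : ℝ) :
    ∃ (w : ℝ → S → ℝ) (r : ℝ → ℝ), DifferentiableAt ℝ w θ₀ ∧ DifferentiableAt ℝ r θ₀ ∧
      ∀ᶠ θ in nhds θ₀, (∀ x, 0 < w θ x) ∧ scaledTilt P f θ *ᵥ w θ = r θ • w θ :=
  exists_differentiableAt_eigenvector (contDiff_scaledTilt_apply P f)
    (isIrreducible_scaledTilt hP f) θ₀

lemma differentiable_evecRatio (hP : P.IsIrreducible) (x y : S) :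
    Differentiable ℝ (evecRatio P f x y) := by
  intro θ₀
  obtain ⟨w, r, hw, -, h⟩ := exists_differentiableAt_eigenvector_scaledTilt hP f θ₀
  exact (hasDerivAt_evecRatio hP hw h x y).differentiableAt

lemma exists_evecRatio_le (hP : P.IsIrreducible) (hsum : ∀ x, ∑ y, P x y = 1)
    (hA1 : (P.submatrix (fun i : maxSet f => (i : S))
      (fun j : maxSet f => (j : S))).IsIrreducible)
    (hA2 : ∀ x, x ∉ maxSet f → ∃ y ∈ maxSet f, 0 < P x y) :
    ∃ K, 0 < K ∧ ∀ θ, 0 ≤ θ → ∀ x y, evecRatio P f x y θ ≤ K := by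
  obtain ⟨K, hK, h⟩ := exists_le_mul hP hsum hA1 hA2
  exact ⟨K, hK, fun θ hθ x y =>
    (div_le_iff₀ (rightEigenvector_pos (isIrreducible_scaledTilt hP f θ) y)).2
      (h _ (rightEigenvector_mem_positiveEigenvectors hP hθ) y x)⟩

lemma bddAbove_ratioValues (hP : P.IsIrreducible) (hsum : ∀ x, ∑ y, P x y = 1)
    (hA1 : (P.submatrix (fun i : maxSet f => (i : S))
      (fun j : maxSet f => (j : S))).IsIrreducible)
    (hA2 : ∀ x, x ∉ maxSet f → ∃ y ∈ maxSet f, 0 < P x y) :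
    BddAbove (ratioValues P f) := by
  obtain ⟨K, -, h⟩ := exists_evecRatio_le hP hsum hA1 hA2
  refine ⟨K, ?_⟩
  rintro _ ⟨θ, hθ, x, y, rfl⟩
  exact h θ hθ x y

lemma bddAbove_ratioDerivValues (hP : P.IsIrreducible) (hsum : ∀ x, ∑ y, P x y = 1)
    (hA1 : (P.submatrix (fun i : maxSet f => (i : S))
      (fun j : maxSet f => (j : S))).IsIrreducible)
    (hA2 : ∀ x, x ∉ maxSet f → ∃ y ∈ maxSet f, 0 < P x y) :
    BddAbove (ratioDerivValues P f) := by
  obtain ⟨K, hK, h⟩ := exists_evecRatio_le hP hsum hA1 hA2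
  obtain ⟨B, hB⟩ := exists_logDeriv_sub_le hP hsum hA1 hA2
  refine ⟨K * B, ?_⟩
  rintro _ ⟨θ, hθ, x, y, rfl⟩
  obtain ⟨w, r, hw, hr, hwr⟩ := exists_differentiableAt_eigenvector_scaledTilt hP f θ
  rw [(hasDerivAt_evecRatio hP hw hwr x y).deriv, abs_mul, abs_of_pos (evecRatio_pos hP x y θ)]
  exact mul_le_mul (h θ hθ x y) (hB θ w r hθ hw hr hwr x y) (abs_nonneg _) hK.le

/-- A bound between two rows of `P` passes to the corresponding entries of the eigenvector. -/
lemma evecRatio_le_of_row_le (hP : P.IsIrreducible) {x y : S} {R : ℝ}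
    (h : ∀ z, P x z ≤ R * P y z) (θ : ℝ) : evecRatio P f x y θ ≤ R := by
  have hirr := isIrreducible_scaledTilt hP f θ
  have hpos := rightEigenvector_pos hirr
  have heq := mulVec_rightEigenvector hirr
  have hr := eigenvalue_pos hirr hpos heq
  rw [evecRatio, div_le_iff₀ (hpos y)]
  refine le_of_mul_le_mul_left ?_ hr
  have hrow : ∀ x, matrixSpectralRadius (scaledTilt P f θ) * rightEigenvector (scaledTilt P f θ) x =
      ∑ z, scaledTilt P f θ x z * rightEigenvector (scaledTilt P f θ) z :=
    fun x => (congrFun heq x).symm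
  rw [mul_left_comm, hrow, hrow, Finset.mul_sum]
  refine Finset.sum_le_sum fun z _ => ?_
  rw [scaledTilt_apply, scaledTilt_apply, ← mul_assoc, ← mul_assoc]
  exact mul_le_mul_of_nonneg_right (mul_le_mul_of_nonneg_right (h z) (Real.exp_pos _).le)
    (hpos z).le

lemma evecRatio_eq_one_of_rows_eq (hP : P.IsIrreducible) (h : ∀ x y z, P x z = P y z) (x y : S) :
    evecRatio P f x y = fun _ => 1 := by
  have hle : ∀ x y θ, evecRatio P f x y θ ≤ 1 := fun x y =>
    evecRatio_le_of_row_le hP fun z => by rw [h x y, one_mul]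
  funext θ
  refine le_antisymm (hle x y θ) ?_
  have hinv : evecRatio P f x y θ = (evecRatio P f y x θ)⁻¹ := (inv_div _ _).symm
  rw [hinv]
  exact (one_le_inv₀ (evecRatio_pos hP y x θ)).2 (hle y x θ)

lemma Ku_le (P : Matrix S S ℝ) (f : S → ℝ) {R : ℝ}
    (h : ∀ θ, 0 ≤ θ → ∀ x y, evecRatio P f x y θ ≤ R) : Ku P f ≤ R := by
  refine csSup_le ⟨_, 0, le_rfl, Classical.arbitrary S, Classical.arbitrary S, rfl⟩ ?_
  rintro _ ⟨θ, hθ, x, y, rfl⟩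
  exact h θ hθ x y

lemma Ku_eq_one_of_rows_eq (hP : P.IsIrreducible) (h : ∀ x y z, P x z = P y z) :
    Ku P f = 1 := by
  have : ratioValues P f = {1} := by
    ext a
    simp only [ratioValues, evecRatio_eq_one_of_rows_eq hP h]
    exact ⟨fun ⟨_, _, _, _, ha⟩ => ha, fun ha =>
      ⟨0, le_rfl, Classical.arbitrary S, Classical.arbitrary S, ha⟩⟩
  rw [Ku, this, csSup_singleton]

lemma Lu_eq_zero_of_rows_eq (hP : P.IsIrreducible) (h : ∀ x y z, P x z = P y z) :
    Lu P f = 0 := by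
  have : ratioDerivValues P f = {0} := by
    ext a
    simp only [ratioDerivValues, evecRatio_eq_one_of_rows_eq hP h, deriv_const, abs_zero]
    exact ⟨fun ⟨_, _, _, _, ha⟩ => ha, fun ha =>
      ⟨0, le_rfl, Classical.arbitrary S, Classical.arbitrary S, ha⟩⟩
  rw [Lu, this, csSup_singleton]

end

end TiltedChain

theorem mainTheorem2 {S : Type*} [Fintype S] [DecidableEq S] [Nonempty S]
    (P : Matrix S S ℝ) (f : S → ℝ)
    (hP_stoch : P ∈ Matrix.rowStochastic ℝ S)
    (hP_irr : P.IsIrreducible)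
    (hA1 : (P.submatrix (fun i : TiltedChain.maxSet f => (i : S))
      (fun j : TiltedChain.maxSet f => (j : S))).IsIrreducible)
    (hA2 : ∀ x, x ∉ TiltedChain.maxSet f → ∃ y ∈ TiltedChain.maxSet f, 0 < P x y) :
    (∀ θ : ℝ, ∃! uv : (S → ℝ) × (S → ℝ),
      TiltedChain.IsPerronFrobeniusPair (TiltedChain.scaledTilt P f θ) uv.1 uv.2) ∧
    (∀ x y : S, Differentiable ℝ (TiltedChain.evecRatio P f x y)) ∧
    BddAbove (TiltedChain.ratioValues P f) ∧
    BddAbove (TiltedChain.ratioDerivValues P f) ∧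
    ((∀ x y z : S, P x z = P y z) → TiltedChain.Ku P f = 1 ∧ TiltedChain.Lu P f = 0) ∧
    ((∀ x y : S, 0 < P x y) →
      TiltedChain.Ku P f ≤ Finset.univ.sup' Finset.univ_nonempty
        (fun t : S × S × S => P t.1 t.2.2 / P t.2.1 t.2.2)) := by
  have hsum : ∀ x, ∑ y, P x y = 1 := Matrix.sum_row_of_mem_rowStochastic hP_stoch
  refine ⟨fun θ => TiltedChain.existsUnique_perronFrobeniusPair
      (TiltedChain.isIrreducible_scaledTilt hP_irr f θ),
    TiltedChain.differentiable_evecRatio hP_irr,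
    TiltedChain.bddAbove_ratioValues hP_irr hsum hA1 hA2,
    TiltedChain.bddAbove_ratioDerivValues hP_irr hsum hA1 hA2,
    fun h => ⟨TiltedChain.Ku_eq_one_of_rows_eq hP_irr h,
      TiltedChain.Lu_eq_zero_of_rows_eq hP_irr h⟩,
    fun hpos => TiltedChain.Ku_le P f fun θ _ x y =>
      TiltedChain.evecRatio_le_of_row_le hP_irr (fun z => ?_) θ⟩
  rw [← div_le_iff₀ (hpos y z)]
  exact Finset.le_sup' (fun t : S × S × S => P t.1 t.2.2 / P t.2.1 t.2.2)
    (Finset.mem_univ (x, y, z))
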